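/- **Setting.** A finite Markov decision process has finite state set $\mathcal S$, finite action set $\mathcal A$, initial distribution $\mu_0$ of $s_0$, transition probabilities $P(s,a,s')$ and reward laws $R(s,a,s',\cdot)$ on $[0,1]$. Each expert $e$ of a finite set $\mathcal E$ is a stationary randomized policy $\pi_e(s,a)$ whose induced chain $\tilde P_e(s,s')=\sum_a P(s,a,s')\pi_e(s,a)$ is irreducible and aperiodic. Let $\mu_e$ be its stationary distribution, and let $C_e\ge 0$, $\alpha_e\in[0,1)$ be any constants such that, for every $t\ge 0$ and every distribution $\mu$ on $\mathcal S$, $\big\|\sum_s \mu(s)\tilde P_e^t(s,\cdot)-\mu_e\big\|_1\le C_e\alpha_e^t$. Put $K_e=C_e/(1-\alpha_e)$ and $$\bar R^e=\sum_{s,a,s'}\Big(\int r\,R(s,a,s',dr)\Big)P(s,a,s')\,\pi_e(s,a)\,\mu_e(s).$$ Let $e^*$ maximize $\bar R^e$ and put $\bar R^*=\bar R^{e^*}$, $K_*=K_{e^*}$, $\Delta_e=\bar R^*-\bar R^e$. **Algorithm.** Let $T_0,T_1,\dots$ be positive integers with $T_n\ge T_0$ for all $n$, and let $t_n=\sum_{m<n}T_m$.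 At iteration $n=0,1,2,\dots$ an expert $e_n$ is chosen and followed during the $T_n$ time steps $t_n\le t<t_{n+1}$; this gives the average reward $X_n=\frac1{T_n}\sum_{t=t_n}^{t_{n+1}-1}r_t$. The UCB algorithm chooses at iteration $n$ an expert $e$ that maximizes $$\frac1k\sum_{m<n,\ e_m=e}X_m+c^e_{k,n},\qquad c^e_{k,n}=\frac{K_e}{T_0}+\sqrt{\frac{8\log n}{k}},$$ where $k$ is the number of times $e$ was chosen in the iterations $0,\dots,n-1$. The index is $+\infty$ if $k=0$, and ties are broken in any way that depends only on the past and on independent randomness. The regret after $n$ iterations is $r(n)=n\bar R^*-\sum_{k=0}^{n-1}X_k$. **Proposition.** Suppose that $\Delta_e>2K_e/T_0$ for every expert $e\ne e^*$. Then for every $n\ge 1$ $$\mathbb E[r(n)]\le\sum_{e\ne e^*}\left(\frac{32\log n}{\left(\Delta_e-\frac{2K_e}{T_0}\right)^2}+1+\frac{\pi^2}3\right)\left(\Delta_e+\frac{K_e}{T_0}\right)+K_*\sum_{k=0}^{n-1}\frac1{T_k}.$$ If moreover $T_n=T_0+\lfloor cn\rfloor$ for all $n$, with a constant $c>0$ (so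 $T_n=T_0+cn$ when $c$ is an integer), then $\mathbb E[r(n)]=O(\log n)$ as $n\to\infty$. -/

import Mathlib

open MeasureTheory Filter Asymptotics
open scoped Matrix Topology ENNReal

noncomputable section

/-- A finite Markov decision process with state set `S` and action set `A`: an initial
distribution, transition probabilities `P s a s'`, and reward laws `R s a s'` on `[0, 1]`. -/
structure RewardMDP (S A : Type*) [Fintype S] [Fintype A] where
  init : S → ℝ
  init_mem : init ∈ stdSimplex ℝ S
  P : S → A → S → ℝ
  P_mem : ∀ s a, P s a ∈ stdSimplex ℝ S
  R : S → A → S → Measure ℝ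
  R_prob : ∀ s a s', IsProbabilityMeasure (R s a s')
  R_supp : ∀ s a s', R s a s' (Set.Icc (0 : ℝ) 1)ᶜ = 0

/-- A stationary (randomized) policy: `prob s a` is the probability of playing `a` in state `s`. -/
structure StationaryPolicy (S A : Type*) [Fintype A] where
  prob : S → A → ℝ
  prob_mem : ∀ s, prob s ∈ stdSimplex ℝ A

/-- The transition matrix of the Markov chain on the states induced by a stationary policy. -/
def RewardMDP.chain {S A : Type*} [Fintype S] [Fintype A] (M : RewardMDP S A)
    (p : StationaryPolicy S A) : Matrix S S ℝ :=
  Matrix.of fun s s' => ∑ a, M.P s a s' * p.prob s a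

/-- Every state is aperiodic: the gcd of the possible return times to it is `1`. -/
def IsAperiodicChain {S : Type*} [Fintype S] [DecidableEq S] (Q : Matrix S S ℝ) : Prop :=
  ∀ s, ∀ d : ℕ, (∀ t : ℕ, 0 < t → 0 < (Q ^ t) s s → d ∣ t) → d = 1

/-- `ν` is a stationary probability distribution of the chain with transition matrix `Q`. -/
def IsStationaryDistribution {S : Type*} [Fintype S] (Q : Matrix S S ℝ) (ν : S → ℝ) : Prop :=
  ν ∈ stdSimplex ℝ S ∧ ν ᵥ* Q = ν

/-- `C`, `α` are mixing constants: from any initial distribution `ρ`, the `ℓ¹` distance to `ν`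
after `t` steps is at most `C * α ^ t`. -/
def IsMixingPair {S : Type*} [Fintype S] [DecidableEq S] (Q : Matrix S S ℝ) (ν : S → ℝ)
    (C α : ℝ) : Prop :=
  0 ≤ α ∧ α < 1 ∧
    ∀ t : ℕ, ∀ ρ ∈ stdSimplex ℝ S, ∑ s, |(ρ ᵥ* Q ^ t) s - ν s| ≤ C * α ^ t

/-- The expected one-step reward of policy `p` when the state has distribution `ν`. -/
def RewardMDP.steadyReward {S A : Type*} [Fintype S] [Fintype A] (M : RewardMDP S A)
    (p : StationaryPolicy S A) (ν : S → ℝ) : ℝ :=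
  ∑ s, ∑ a, ∑ s', (∫ x, x ∂(M.R s a s')) * M.P s a s' * p.prob s a * ν s

/-- `startTime T n = T 0 + ⋯ + T (n - 1)`, the MDP time at which iteration `n` starts. -/
def startTime (T : ℕ → ℕ) (n : ℕ) : ℕ := ∑ m ∈ Finset.range n, T m

/-- The average reward collected during iteration `n`. -/
def avgReward {Ω : Type*} (T : ℕ → ℕ) (r : ℕ → Ω → ℝ) (n : ℕ) (ω : Ω) : ℝ :=
  (∑ j ∈ Finset.range (T n), r (startTime T n + j) ω) / (T n : ℝ)

/-- The number of iterations `m < n` in which expert `e` is chosen. -/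
def pullCount {Ω E : Type*} [DecidableEq E] (choice : ℕ → Ω → E) (e : E) (n : ℕ) (ω : Ω) : ℕ :=
  ((Finset.range n).filter fun m => choice m ω = e).card

/-- The sum of the average rewards collected in the iterations `m < n` in which `e` is chosen. -/
def pullSum {Ω E : Type*} [DecidableEq E] (T : ℕ → ℕ) (r : ℕ → Ω → ℝ) (choice : ℕ → Ω → E)
    (e : E) (n : ℕ) (ω : Ω) : ℝ :=
  ∑ m ∈ (Finset.range n).filter (fun m => choice m ω = e), avgReward T r m ω

/-- The confidence bound `K / T₀ + √(8 log n / k)`. -/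
def confBound (K : ℝ) (T0 : ℕ) (k n : ℕ) : ℝ :=
  K / (T0 : ℝ) + √(8 * Real.log (n : ℝ) / (k : ℝ))

/-- The upper confidence index of expert `e` at the start of iteration `n`: the empirical mean
plus the confidence bound, and `∞` as long as `e` has not been chosen. -/
def ucbIndex {Ω E : Type*} [DecidableEq E] (K : E → ℝ) (T : ℕ → ℕ) (r : ℕ → Ω → ℝ)
    (choice : ℕ → Ω → E) (e : E) (n : ℕ) (ω : Ω) : EReal :=
  if pullCount choice e n ω = 0 then ⊤
  else ((pullSum T r choice e n ω / (pullCount choice e n ω : ℝ)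
    + confBound (K e) (T 0) (pullCount choice e n ω) n : ℝ) : EReal)

/-- The processes `s` (states), `a` (actions), `r` (rewards) and `choice` (expert chosen at each
iteration) on the probability space `(Ω, μ)` are a run of the bandit scheme on the MDP `M` with
experts `π` and horizons `T`. The σ-algebra `ℱ t` is the information available just before the
action `a t` is drawn; it may contain more than the past of the processes (for example a source of
random tie-breaking), and the experts may be chosen in any way that is causal with respect to it.
During iteration `n`, given `ℱ t`, the action is drawn from the chosen expert's policy at the
current state, then the next state from `P`, then the reward from `R`. -/
structure IsBanditRun {S A E Ω : Type*} [Fintype S] [Fintype A] [mΩ : MeasurableSpace Ω]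
    (M : RewardMDP S A) (π : E → StationaryPolicy S A) (T : ℕ → ℕ) (μ : Measure Ω)
    (ℱ : Filtration ℕ mΩ) (s : ℕ → Ω → S) (a : ℕ → Ω → A) (r : ℕ → Ω → ℝ)
    (choice : ℕ → Ω → E) : Prop where
  state_meas : ∀ t x, MeasurableSet[ℱ t] {ω | s t ω = x}
  action_meas : ∀ t x, MeasurableSet[ℱ (t + 1)] {ω | a t ω = x}
  reward_meas : ∀ t, Measurable[ℱ (t + 1)] (r t)
  choice_meas : ∀ n x, MeasurableSet[ℱ (startTime T n)] {ω | choice n ω = x}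
  init_law : ∀ x, μ.real {ω | s 0 ω = x} = M.init x
  step_law : ∀ n, ∀ j < T n, ∀ (x : A) (y : S) (B : Set ℝ), MeasurableSet B →
    μ[Set.indicator {ω | a (startTime T n + j) ω = x ∧ s (startTime T n + j + 1) ω = y ∧
        r (startTime T n + j) ω ∈ B} (fun _ => (1 : ℝ)) | ℱ (startTime T n + j)]
      =ᵐ[μ] fun ω => (π (choice n ω)).prob (s (startTime T n + j) ω) x
        * M.P (s (startTime T n + j) ω) x y * (M.R (s (startTime T n + j) ω) x y).real B

/-- Almost surely, at every iteration the chosen expert maximizes the upper confidence index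
(ties being broken arbitrarily). -/
def FollowsUCB {E Ω : Type*} [DecidableEq E] [MeasurableSpace Ω] (K : E → ℝ) (T : ℕ → ℕ)
    (μ : Measure Ω) (r : ℕ → Ω → ℝ) (choice : ℕ → Ω → E) : Prop :=
  ∀ᵐ ω ∂μ, ∀ n e, ucbIndex K T r choice e n ω ≤ ucbIndex K T r choice (choice n ω) n ω

/-- The cumulative regret after `n` iterations, against the steady-state reward `Rstar`. -/
def regret {Ω : Type*} (T : ℕ → ℕ) (r : ℕ → Ω → ℝ) (Rstar : ℝ) (n : ℕ) (ω : Ω) : ℝ :=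
  (n : ℝ) * Rstar - ∑ k ∈ Finset.range n, avgReward T r k ω

end

/-!
Given the past, the average reward of an iteration that starts from the state `x` under the expert
`e` has conditional mean `M.blockMean (π e) (T n) x`. The states of the iteration form a Markov
chain under the chosen expert, so the mixing bound makes the one-step expected rewards converge
geometrically, and summing the geometric series puts this mean within `K e / T n` of the
steady-state reward `Rbar e` (`RewardMDP.abs_blockMean_sub_le`). The restarts from arbitrary states
thus cost a bias of at most `K e / T 0`, which the confidence bound already contains; what remains
is the usual UCB argument for rewards that are bounded martingale differences up to this bias.

For the concentration no conditional law is needed. For a fixed exponent `l` and a bound `b` on the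
conditional means (from above if `0 ≤ l`, from below if `l ≤ 0`), the process
`exp (l * (pullSum - pullCount * b) - pullCount * l ^ 2 / 2)` has expectation at most `1`
(`IsBanditRun.integral_expWeight_le_one`): by convexity of `exp` on `[0, 1]` only the conditional
mean of the reward enters, through `IsBanditRun.setIntegral_mul_avgReward`. Markov's inequality, on
the event that `e` has been used exactly `k` times before iteration `n`, gives a deviation
probability of at most `n⁻⁴`; the union over `k ≤ n` costs a factor `n`.

A suboptimal expert used more than `32 log n / (Δ e - 2 K e / T 0) ^ 2` times can be chosen again
only if its own empirical mean or that of the best expert deviates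
(`deviation_of_ucbIndex_le`). Summing the probabilities bounds the expected number of uses by the
logarithmic term plus `1 + 2 ζ(2)` (`IsBanditRun.integral_pullCount_le`). The expected regret is the
sum of the gaps weighted by the probabilities of use, up to a bias `K e / T k` per iteration
(`IsBanditRun.abs_integral_regret_sub_le`), which yields the first bound. For horizons that grow
linearly the sum of `1 / T k` is logarithmic, by comparison with the harmonic series; since the
regret may be negative, the order of growth also uses the corresponding lower bound
(`IsBanditRun.neg_le_integral_regret`).
-/

/-! ### Exponential moments of a variable with values in the unit interval -/

theorem exp_mul_le_one_add_mul (l : ℝ) {x : ℝ} (hx : x ∈ Set.Icc (0 : ℝ) 1) :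
    Real.exp (l * x) ≤ 1 + x * (Real.exp l - 1) := by
  have h := convexOn_exp.2 (Set.mem_univ 0) (Set.mem_univ l) (sub_nonneg.2 hx.2) hx.1
    (sub_add_cancel 1 x)
  simp only [smul_eq_mul, mul_zero, zero_add, Real.exp_zero, mul_one] at h
  rw [mul_comm l x]
  linarith

theorem exp_mul_le_cosh_add_mul_sinh (l : ℝ) {y : ℝ} (hy : y ∈ Set.Icc (-1 : ℝ) 1) :
    Real.exp (l * y) ≤ Real.cosh l + y * Real.sinh l := by
  have h := convexOn_exp.2 (Set.mem_univ (-l)) (Set.mem_univ l)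
    (show 0 ≤ (1 - y) / 2 by linarith [hy.2]) (show 0 ≤ (1 + y) / 2 by linarith [hy.1]) (by ring)
  simp only [smul_eq_mul] at h
  rw [Real.cosh_eq, Real.sinh_eq]
  calc Real.exp (l * y) = Real.exp ((1 - y) / 2 * -l + (1 + y) / 2 * l) := by ring_nf
    _ ≤ _ := h
    _ = _ := by ring

/-- The moment generating function of a Bernoulli variable of mean `p`: a Hoeffding bound, with
the constant `1 / 2` in place of the optimal `1 / 8`. -/
theorem one_add_mul_exp_sub_one_le (l : ℝ) {p : ℝ} (hp : p ∈ Set.Icc (0 : ℝ) 1) :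
    1 + p * (Real.exp l - 1) ≤ Real.exp (l * p + l ^ 2 / 2) := by
  obtain ⟨h0, h1⟩ := hp
  have hA := exp_mul_le_cosh_add_mul_sinh l (y := 1 - p) ⟨by linarith, by linarith⟩
  have hB := exp_mul_le_cosh_add_mul_sinh l (y := -p) ⟨by linarith, by linarith⟩
  -- the two values of the centred variable, averaged, make the `sinh` terms cancel
  have hC : p * Real.exp (l * (1 - p)) + (1 - p) * Real.exp (l * -p) ≤ Real.exp (l ^ 2 / 2) := by
    have := Real.cosh_le_exp_half_sq l
    nlinarith [mul_le_mul_of_nonneg_left hA h0, mul_le_mul_of_nonneg_left hB (sub_nonneg.2 h1)]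
  calc 1 + p * (Real.exp l - 1)
      = Real.exp (l * p) * (p * Real.exp (l * (1 - p)) + (1 - p) * Real.exp (l * -p)) := by
        have e1 : Real.exp (l * p) * Real.exp (l * (1 - p)) = Real.exp l := by
          rw [← Real.exp_add]; ring_nf
        have e2 : Real.exp (l * p) * Real.exp (l * -p) = 1 := by
          rw [← Real.exp_add, ← Real.exp_zero]; ring_nf
        linear_combination (-p) * e1 - (1 - p) * e2
    _ ≤ Real.exp (l * p) * Real.exp (l ^ 2 / 2) :=
        mul_le_mul_of_nonneg_left hC (Real.exp_pos _).le
    _ = _ := (Real.exp_add _ _).symm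

/-! ### Expected reward of a policy over a block of steps -/

theorem RewardMDP.nonempty_state {S A : Type*} [Fintype S] [Fintype A] (M : RewardMDP S A) :
    Nonempty S := by
  by_contra h
  rw [not_nonempty_iff] at h
  simpa using M.init_mem.2

section Policy

variable {S A : Type*} [Fintype S] [Fintype A] (M : RewardMDP S A) (p : StationaryPolicy S A)

/-- The expected one-step reward of the policy `p` in the state `x`. -/
noncomputable def RewardMDP.stateReward (x : S) : ℝ :=
  ∑ a, ∑ y, (∫ z, z ∂(M.R x a y)) * M.P x a y * p.prob x a

theorem RewardMDP.steadyReward_eq_sum (ν : S → ℝ) :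
    M.steadyReward p ν = ∑ x, ν x * M.stateReward p x := by
  simp only [RewardMDP.steadyReward, RewardMDP.stateReward, Finset.mul_sum]
  exact Finset.sum_congr rfl fun _ _ => Finset.sum_congr rfl fun _ _ =>
    Finset.sum_congr rfl fun _ _ => mul_comm _ _

theorem RewardMDP.integral_R_mem (x : S) (b : A) (y : S) :
    ∫ z, z ∂(M.R x b y) ∈ Set.Icc (0 : ℝ) 1 := by
  have := M.R_prob x b y
  have h : ∀ᵐ z ∂(M.R x b y), z ∈ Set.Icc (0 : ℝ) 1 := M.R_supp x b y
  refine ⟨integral_nonneg_of_ae (h.mono fun z hz => hz.1), ?_⟩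
  have hi : Integrable (fun z : ℝ => z) (M.R x b y) :=
    Integrable.of_mem_Icc 0 1 aemeasurable_id h
  simpa using integral_mono_ae hi (integrable_const (1 : ℝ)) (h.mono fun z hz => hz.2)

theorem RewardMDP.stateReward_mem (x : S) : M.stateReward p x ∈ Set.Icc (0 : ℝ) 1 := by
  have hP := fun b => M.P_mem x b
  have hp := p.prob_mem x
  refine ⟨Finset.sum_nonneg fun b _ => Finset.sum_nonneg fun y _ => mul_nonneg
    (mul_nonneg (M.integral_R_mem x b y).1 ((hP b).1 y)) (hp.1 b), ?_⟩
  calc M.stateReward p x ≤ ∑ b, ∑ y, M.P x b y * p.prob x b := by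
        refine Finset.sum_le_sum fun b _ => Finset.sum_le_sum fun y _ => ?_
        exact mul_le_mul_of_nonneg_right
          (mul_le_of_le_one_left ((hP b).1 y) (M.integral_R_mem x b y).2) (hp.1 b)
    _ = 1 := by simp only [← Finset.sum_mul, (hP _).2, one_mul, hp.2]

variable [DecidableEq S]

theorem RewardMDP.chain_mem_rowStochastic : M.chain p ∈ Matrix.rowStochastic ℝ S := by
  rw [Matrix.mem_rowStochastic_iff_sum]
  refine ⟨fun x y => Finset.sum_nonneg fun b _ =>
    mul_nonneg ((M.P_mem x b).1 y) ((p.prob_mem x).1 b), fun x => ?_⟩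
  simp only [RewardMDP.chain, Matrix.of_apply]
  rw [Finset.sum_comm]
  simp only [← Finset.sum_mul, (M.P_mem _ _).2, one_mul, (p.prob_mem x).2]

/-- The expected average reward over `N` consecutive steps under the policy `p`, started in the
state `x`. -/
noncomputable def RewardMDP.blockMean (N : ℕ) (x : S) : ℝ :=
  (∑ j ∈ Finset.range N, ∑ y, (M.chain p ^ j) x y * M.stateReward p y) / N

theorem RewardMDP.blockMean_mem (N : ℕ) (x : S) : M.blockMean p N x ∈ Set.Icc (0 : ℝ) 1 := by
  have hst := fun j => Matrix.mem_rowStochastic_iff_sum.1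
    (pow_mem (M.chain_mem_rowStochastic p) j)
  have hr := M.stateReward_mem p
  refine ⟨div_nonneg (Finset.sum_nonneg fun j _ => Finset.sum_nonneg fun y _ =>
    mul_nonneg ((hst j).1 x y) (hr y).1) N.cast_nonneg, div_le_one_of_le₀ ?_ N.cast_nonneg⟩
  calc ∑ j ∈ Finset.range N, ∑ y, (M.chain p ^ j) x y * M.stateReward p y
      ≤ ∑ j ∈ Finset.range N, ∑ y, (M.chain p ^ j) x y :=
        Finset.sum_le_sum fun j _ => Finset.sum_le_sum fun y _ =>
          mul_le_of_le_one_right ((hst j).1 x y) (hr y).2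
    _ = N := by simp [(hst _).2]

/-- Mixing from a deterministic start: the geometric series of the `ℓ¹` errors bounds the bias of
the average over a block. -/
theorem RewardMDP.abs_blockMean_sub_le {ν : S → ℝ} {C α : ℝ}
    (h : IsMixingPair (M.chain p) ν C α) (hC : 0 ≤ C) {N : ℕ} (hN : 0 < N) (x : S) :
    |M.blockMean p N x - M.steadyReward p ν| ≤ C / (1 - α) / N := by
  obtain ⟨h0, h1, hm⟩ := h
  have hN' : (0 : ℝ) < N := Nat.cast_pos.2 hN
  have hterm : ∀ j, |(∑ y, (M.chain p ^ j) x y * M.stateReward p y) - M.steadyReward p ν|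
      ≤ C * α ^ j := by
    intro j
    refine le_trans ?_ (hm j (Pi.single x 1) (single_mem_stdSimplex ℝ x))
    rw [M.steadyReward_eq_sum, ← Finset.sum_sub_distrib]
    refine (Finset.abs_sum_le_sum_abs _ _).trans (Finset.sum_le_sum fun y _ => ?_)
    rw [Matrix.single_one_vecMul, ← sub_mul, abs_mul, Matrix.row]
    have hr := M.stateReward_mem p y
    exact mul_le_of_le_one_right (abs_nonneg _) (by rw [abs_of_nonneg hr.1]; exact hr.2)
  have hsum : M.blockMean p N x - M.steadyReward p ν
      = (∑ j ∈ Finset.range N,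
          ((∑ y, (M.chain p ^ j) x y * M.stateReward p y) - M.steadyReward p ν)) / N := by
    rw [RewardMDP.blockMean, Finset.sum_sub_distrib]
    simp only [Finset.sum_const, Finset.card_range, nsmul_eq_mul]
    field_simp
  rw [hsum, abs_div, abs_of_pos hN']
  refine div_le_div_of_nonneg_right ?_ hN'.le
  calc _ ≤ ∑ j ∈ Finset.range N, C * α ^ j :=
        (Finset.abs_sum_le_sum_abs _ _).trans (Finset.sum_le_sum fun j _ => hterm j)
    _ = C * ∑ j ∈ Finset.range N, α ^ j := (Finset.mul_sum _ _ _).symm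
    _ ≤ C * (1 - α)⁻¹ := by
        refine mul_le_mul_of_nonneg_left ?_ hC
        rw [← tsum_geometric_of_lt_one h0 h1]
        exact (summable_geometric_of_lt_one h0 h1).sum_le_tsum _ fun j _ => pow_nonneg h0 j
    _ = _ := (div_eq_mul_inv _ _).symm

theorem IsMixingPair.nonneg_left {Q : Matrix S S ℝ} {ν : S → ℝ} {C α : ℝ}
    (h : IsMixingPair Q ν C α) (x : S) : 0 ≤ C := by
  have := h.2.2 0 (Pi.single x 1) (single_mem_stdSimplex ℝ x)
  rw [pow_zero, pow_zero, mul_one] at this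
  exact (Finset.sum_nonneg fun y _ => abs_nonneg _).trans this

end Policy

/-! ### Splitting along a finite-valued function -/

section Fibers

variable {Ω ι : Type*} [MeasurableSpace Ω] {μ : Measure Ω} [Fintype ι]

theorem setIntegral_eq_sum_fiber {f : Ω → ℝ} (hf : Integrable f μ) {g : Ω → ι}
    (hg : ∀ i, MeasurableSet {ω | g ω = i}) {D : Set Ω} (hD : MeasurableSet D) :
    ∫ ω in D, f ω ∂μ = ∑ i, ∫ ω in D ∩ {ω | g ω = i}, f ω ∂μ := by
  rw [← integral_iUnion_fintype (fun i => hD.inter (hg i)) ?_ fun i => hf.integrableOn]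
  · congr 2
    ext ω
    simp
  · intro i j hij
    refine Set.disjoint_left.2 fun ω hi hj => hij ?_
    exact hi.2.symm.trans hj.2

theorem integral_eq_sum_fiber {f : Ω → ℝ} (hf : Integrable f μ) {g : Ω → ι}
    (hg : ∀ i, MeasurableSet {ω | g ω = i}) :
    ∫ ω, f ω ∂μ = ∑ i, ∫ ω in {ω | g ω = i}, f ω ∂μ := by
  simpa using setIntegral_eq_sum_fiber hf hg MeasurableSet.univ

theorem measureReal_eq_sum_fiber [IsFiniteMeasure μ] {g : Ω → ι}
    (hg : ∀ i, MeasurableSet {ω | g ω = i}) {D : Set Ω} (hD : MeasurableSet D) :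
    μ.real D = ∑ i, μ.real (D ∩ {ω | g ω = i}) := by
  simpa using setIntegral_eq_sum_fiber (integrable_const (1 : ℝ)) hg hD

end Fibers

/-! ### The law of a run during one iteration -/

theorem startTime_succ (T : ℕ → ℕ) (n : ℕ) : startTime T (n + 1) = startTime T n + T n :=
  Finset.sum_range_succ _ _

theorem startTime_mono (T : ℕ → ℕ) : Monotone (startTime T) :=
  monotone_nat_of_le_succ fun n => by rw [startTime_succ]; exact Nat.le_add_right _ _

namespace IsBanditRun

variable {S A E Ω : Type*} [Fintype S] [Fintype A] [mΩ : MeasurableSpace Ω]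
  {M : RewardMDP S A} {π : E → StationaryPolicy S A} {T : ℕ → ℕ} {μ : Measure Ω}
  {ℱ : Filtration ℕ mΩ} {s : ℕ → Ω → S} {a : ℕ → Ω → A} {r : ℕ → Ω → ℝ} {choice : ℕ → Ω → E}

theorem measurableSet_state (h : IsBanditRun M π T μ ℱ s a r choice) (t : ℕ) (x : S) :
    MeasurableSet {ω | s t ω = x} :=
  ℱ.le _ _ (h.state_meas t x)

theorem measurableSet_action (h : IsBanditRun M π T μ ℱ s a r choice) (t : ℕ) (b : A) :
    MeasurableSet {ω | a t ω = b} :=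
  ℱ.le _ _ (h.action_meas t b)

theorem measurableSet_choice (h : IsBanditRun M π T μ ℱ s a r choice) (n : ℕ) (e : E) :
    MeasurableSet {ω | choice n ω = e} :=
  ℱ.le _ _ (h.choice_meas n e)

theorem measurable_reward (h : IsBanditRun M π T μ ℱ s a r choice) (t : ℕ) : Measurable (r t) :=
  (h.reward_meas t).mono (ℱ.le _) le_rfl

theorem measurable_avgReward_of_lt (h : IsBanditRun M π T μ ℱ s a r choice) {m n : ℕ}
    (hmn : m < n) : Measurable[ℱ (startTime T n)] (avgReward T r m) := by
  have hj : ∀ j ∈ Finset.range (T m), Measurable[ℱ (startTime T n)] (r (startTime T m + j)) := by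
    intro j hj
    refine (h.reward_meas _).mono (ℱ.mono ?_) le_rfl
    have h1 := startTime_mono T (Nat.succ_le_of_lt hmn)
    rw [Nat.succ_eq_add_one, startTime_succ] at h1
    have := Finset.mem_range.1 hj
    omega
  exact (Finset.measurable_fun_sum _ hj).div_const _

theorem measurable_avgReward (h : IsBanditRun M π T μ ℱ s a r choice) (n : ℕ) :
    Measurable (avgReward T r n) :=
  (h.measurable_avgReward_of_lt n.lt_succ_self).mono (ℱ.le _) le_rfl

variable [IsProbabilityMeasure μ]

/-- The step law in integrated form, on an event of the past on which the expert and the current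
state are known. -/
theorem measureReal_inter_step (h : IsBanditRun M π T μ ℱ s a r choice) {n j : ℕ} (hj : j < T n)
    {e : E} {x : S} {D : Set Ω} (hD : MeasurableSet[ℱ (startTime T n + j)] D)
    (hDe : ∀ ω ∈ D, choice n ω = e ∧ s (startTime T n + j) ω = x)
    (b : A) (y : S) {B : Set ℝ} (hB : MeasurableSet B) :
    μ.real (D ∩ {ω | a (startTime T n + j) ω = b ∧ s (startTime T n + j + 1) ω = y ∧
      r (startTime T n + j) ω ∈ B})
      = μ.real D * ((π e).prob x b * M.P x b y * (M.R x b y).real B) := by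
  set V := {ω | a (startTime T n + j) ω = b ∧ s (startTime T n + j + 1) ω = y ∧
      r (startTime T n + j) ω ∈ B} with hV
  have hVm : MeasurableSet V := (h.measurableSet_action _ b).inter
    ((h.measurableSet_state _ y).inter (h.measurable_reward _ hB))
  have hDm := ℱ.le _ _ hD
  have h1 := setIntegral_condExp (μ := μ) (ℱ.le (startTime T n + j))
    ((integrable_const (1 : ℝ)).indicator hVm) hD
  rw [setIntegral_indicator hVm] at h1
  rw [setIntegral_congr_ae (g := fun _ => (π e).prob x b * M.P x b y * (M.R x b y).real B) hDm] at h1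
  · simpa using h1.symm
  · filter_upwards [h.step_law n j hj b y B hB] with ω hω hωD
    rw [hω, (hDe ω hωD).1, (hDe ω hωD).2]

theorem measureReal_inter_next_state (h : IsBanditRun M π T μ ℱ s a r choice) {n j : ℕ}
    (hj : j < T n) {e : E} {x : S} {D : Set Ω} (hD : MeasurableSet[ℱ (startTime T n + j)] D)
    (hDe : ∀ ω ∈ D, choice n ω = e ∧ s (startTime T n + j) ω = x) (y : S) :
    μ.real (D ∩ {ω | s (startTime T n + j + 1) ω = y}) = μ.real D * M.chain (π e) x y := by
  have hDm := ℱ.le _ _ hD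
  rw [measureReal_eq_sum_fiber (h.measurableSet_action (startTime T n + j))
    (hDm.inter (h.measurableSet_state _ y)), RewardMDP.chain, Matrix.of_apply, Finset.mul_sum]
  refine Finset.sum_congr rfl fun b _ => ?_
  have := M.R_prob x b y
  have h1 := h.measureReal_inter_step hj hD hDe b y MeasurableSet.univ
  rw [probReal_univ, mul_one, mul_comm ((π e).prob x b)] at h1
  rw [← h1]
  congr 1
  ext ω
  simp only [Set.mem_inter_iff, Set.mem_ofPred_eq, Set.mem_univ]
  tauto

theorem reward_mem [Finite E] (h : IsBanditRun M π T μ ℱ s a r choice) {n j : ℕ}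
    (hj : j < T n) : ∀ᵐ ω ∂μ, r (startTime T n + j) ω ∈ Set.Icc (0 : ℝ) 1 := by
  have key : ∀ (e : E) (x : S) (b : A) (y : S), ∀ᵐ ω ∂μ,
      ω ∉ ({ω | choice n ω = e} ∩ {ω | s (startTime T n + j) ω = x}) ∩
        {ω | a (startTime T n + j) ω = b ∧ s (startTime T n + j + 1) ω = y ∧
          r (startTime T n + j) ω ∈ (Set.Icc (0 : ℝ) 1)ᶜ} := by
    intro e x b y
    refine measure_eq_zero_iff_ae_notMem.1 ?_
    have hD : MeasurableSet[ℱ (startTime T n + j)]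
        ({ω | choice n ω = e} ∩ {ω | s (startTime T n + j) ω = x}) :=
      MeasurableSet.inter (ℱ.mono (Nat.le_add_right _ _) _ (h.choice_meas n e))
        (h.state_meas _ x)
    rw [← measureReal_eq_zero_iff, h.measureReal_inter_step hj hD (fun ω hω => ⟨hω.1, hω.2⟩) b y
      measurableSet_Icc.compl, Measure.real, Measure.real, M.R_supp]
    simp
  simp only [← ae_all_iff] at key
  filter_upwards [key] with ω hω
  by_contra hr
  exact hω _ _ _ _ ⟨⟨rfl, rfl⟩, rfl, rfl, hr⟩

theorem integrable_reward [Finite E] (h : IsBanditRun M π T μ ℱ s a r choice) {n j : ℕ}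
    (hj : j < T n) : Integrable (r (startTime T n + j)) μ :=
  Integrable.of_mem_Icc 0 1 (h.measurable_reward _).aemeasurable (h.reward_mem hj)

theorem avgReward_mem [Finite E] (h : IsBanditRun M π T μ ℱ s a r choice) (n : ℕ) :
    ∀ᵐ ω ∂μ, avgReward T r n ω ∈ Set.Icc (0 : ℝ) 1 := by
  have : ∀ᵐ ω ∂μ, ∀ j : Fin (T n), r (startTime T n + j) ω ∈ Set.Icc (0 : ℝ) 1 :=
    ae_all_iff.2 fun j => h.reward_mem j.2
  filter_upwards [this] with ω hω
  have hω' : ∀ j ∈ Finset.range (T n), r (startTime T n + j) ω ∈ Set.Icc (0 : ℝ) 1 :=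
    fun j hj => hω ⟨j, Finset.mem_range.1 hj⟩
  refine ⟨div_nonneg (Finset.sum_nonneg fun j hj => (hω' j hj).1) (Nat.cast_nonneg _),
    div_le_one_of_le₀ ?_ (Nat.cast_nonneg _)⟩
  simpa using Finset.sum_le_sum fun j hj => (hω' j hj).2

theorem integrable_avgReward [Finite E] (h : IsBanditRun M π T μ ℱ s a r choice) (n : ℕ) :
    Integrable (avgReward T r n) μ :=
  Integrable.of_mem_Icc 0 1 (h.measurable_avgReward n).aemeasurable (h.avgReward_mem n)

theorem integrable_mul_exp_avgReward [Finite E] (h : IsBanditRun M π T μ ℱ s a r choice) (n : ℕ)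
    (l : ℝ) {Z : Ω → ℝ} (hZi : Integrable Z μ) :
    Integrable (fun ω => Z ω * Real.exp (l * avgReward T r n ω)) μ := by
  refine hZi.mul_bdd (c := Real.exp |l|)
    (Real.measurable_exp.comp ((h.measurable_avgReward n).const_mul l)).aestronglyMeasurable ?_
  filter_upwards [h.avgReward_mem n] with ω hω
  rw [Real.norm_of_nonneg (Real.exp_pos _).le]
  refine Real.exp_le_exp.2 ((le_abs_self _).trans ?_)
  rw [abs_mul, abs_of_nonneg hω.1]
  exact mul_le_of_le_one_right (abs_nonneg l) hω.2

theorem setIntegral_reward [Finite E] (h : IsBanditRun M π T μ ℱ s a r choice) {n j : ℕ}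
    (hj : j < T n) {e : E} {x : S} {D : Set Ω} (hD : MeasurableSet[ℱ (startTime T n + j)] D)
    (hDe : ∀ ω ∈ D, choice n ω = e ∧ s (startTime T n + j) ω = x) :
    ∫ ω in D, r (startTime T n + j) ω ∂μ = μ.real D * M.stateReward (π e) x := by
  have hDm := ℱ.le _ _ hD
  have hr := h.integrable_reward hj
  rw [setIntegral_eq_sum_fiber hr (h.measurableSet_action (startTime T n + j)) hDm,
    RewardMDP.stateReward, Finset.mul_sum]
  refine Finset.sum_congr rfl fun b _ => ?_
  have hDb := hDm.inter (h.measurableSet_action (startTime T n + j) b)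
  rw [setIntegral_eq_sum_fiber hr (h.measurableSet_state (startTime T n + j + 1)) hDb,
    Finset.mul_sum]
  refine Finset.sum_congr rfl fun y _ => ?_
  have := M.R_prob x b y
  set D' := D ∩ {ω | a (startTime T n + j) ω = b} ∩ {ω | s (startTime T n + j + 1) ω = y}
  have hc : 0 ≤ μ.real D * ((π e).prob x b * M.P x b y) :=
    mul_nonneg measureReal_nonneg (mul_nonneg (((π e).prob_mem x).1 b) ((M.P_mem x b).1 y))
  -- the reward law, restricted to `D'`, is a multiple of `R x b y`
  have hmap : (μ.restrict D').map (r (startTime T n + j))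
      = ENNReal.ofReal (μ.real D * ((π e).prob x b * M.P x b y)) • M.R x b y := by
    ext B hB
    rw [Measure.map_apply (h.measurable_reward _) hB, Measure.restrict_apply
      (h.measurable_reward _ hB), Measure.smul_apply, smul_eq_mul]
    have h1 := h.measureReal_inter_step hj hD hDe b y hB
    rw [← mul_assoc] at h1
    rw [← ofReal_measureReal (μ := M.R x b y) (s := B), ← ENNReal.ofReal_mul hc, ← h1,
      ofReal_measureReal]
    congr 1
    ext ω
    simp only [D', Set.mem_inter_iff, Set.mem_preimage, Set.mem_ofPred_eq]
    tauto
  have h2 := integral_map (μ := μ.restrict D') (h.measurable_reward (startTime T n + j)).aemeasurable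
    (f := fun z : ℝ => z) aestronglyMeasurable_id
  rw [← h2, hmap, integral_smul_measure, ENNReal.toReal_ofReal hc, smul_eq_mul]
  ring

variable [DecidableEq S]

/-- Within one iteration the states form a Markov chain under the chosen expert. -/
theorem measureReal_inter_state (h : IsBanditRun M π T μ ℱ s a r choice) {n : ℕ}
    {e : E} {x : S} {D : Set Ω} (hD : MeasurableSet[ℱ (startTime T n)] D)
    (hDe : ∀ ω ∈ D, choice n ω = e ∧ s (startTime T n) ω = x) {j : ℕ} (hj : j ≤ T n) (y : S) :
    μ.real (D ∩ {ω | s (startTime T n + j) ω = y}) = μ.real D * (M.chain (π e) ^ j) x y := by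
  induction j generalizing y with
  | zero =>
    rw [pow_zero, Matrix.one_apply, add_zero]
    split_ifs with hxy
    · have h1 : D ∩ {ω | s (startTime T n) ω = y} = D :=
        Set.inter_eq_left.2 fun ω hω => (hDe ω hω).2.trans hxy
      rw [mul_one, h1]
    · have h1 : D ∩ {ω | s (startTime T n) ω = y} = ∅ :=
        Set.eq_empty_of_forall_notMem fun ω hω => hxy ((hDe ω hω.1).2.symm.trans hω.2)
      rw [mul_zero, h1, measureReal_empty]
  | succ j ih =>
    have hDj : MeasurableSet[ℱ (startTime T n + j)] D := ℱ.mono (Nat.le_add_right _ _) _ hD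
    rw [measureReal_eq_sum_fiber (h.measurableSet_state (startTime T n + j))
      ((ℱ.le _ _ hD).inter (h.measurableSet_state _ y)), pow_succ, Matrix.mul_apply,
      Finset.mul_sum]
    refine Finset.sum_congr rfl fun z _ => ?_
    rw [← mul_assoc, ← ih (Nat.le_of_succ_le hj) z, Set.inter_right_comm, ← add_assoc]
    exact h.measureReal_inter_next_state (Nat.lt_of_succ_le hj)
      (MeasurableSet.inter hDj (h.state_meas _ z)) (fun ω hω => ⟨(hDe ω hω.1).1, hω.2⟩) y

theorem setIntegral_avgReward [Finite E] (h : IsBanditRun M π T μ ℱ s a r choice) {n : ℕ}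
    {e : E} {x : S} {D : Set Ω} (hD : MeasurableSet[ℱ (startTime T n)] D)
    (hDe : ∀ ω ∈ D, choice n ω = e ∧ s (startTime T n) ω = x) :
    ∫ ω in D, avgReward T r n ω ∂μ = μ.real D * M.blockMean (π e) (T n) x := by
  simp only [avgReward, RewardMDP.blockMean]
  rw [integral_div, integral_finsetSum _ fun j hj =>
    (h.integrable_reward (Finset.mem_range.1 hj)).integrableOn, ← mul_div_assoc, Finset.mul_sum]
  congr 1
  refine Finset.sum_congr rfl fun j hj => ?_
  have hj' := Finset.mem_range.1 hj
  rw [setIntegral_eq_sum_fiber (h.integrable_reward hj')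
    (h.measurableSet_state (startTime T n + j)) (ℱ.le _ _ hD), Finset.mul_sum]
  refine Finset.sum_congr rfl fun y _ => ?_
  rw [← mul_assoc, ← h.measureReal_inter_state hD hDe hj'.le y]
  exact h.setIntegral_reward hj' (MeasurableSet.inter (ℱ.mono (Nat.le_add_right _ _) _ hD)
    (h.state_meas _ y)) fun ω hω => ⟨(hDe ω hω.1).1, hω.2⟩

/-- On the event that the iteration starts from the state `x` with the expert `e`, the average
reward may be replaced by its conditional expectation in integrals against the past. -/
theorem setIntegral_mul_avgReward [Finite E] (h : IsBanditRun M π T μ ℱ s a r choice)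
    (n : ℕ) (e : E) (x : S) {Z : Ω → ℝ} (hZ : StronglyMeasurable[ℱ (startTime T n)] Z)
    (hZi : Integrable Z μ) :
    ∫ ω in {ω | choice n ω = e} ∩ {ω | s (startTime T n) ω = x}, Z ω * avgReward T r n ω ∂μ
      = (∫ ω in {ω | choice n ω = e} ∩ {ω | s (startTime T n) ω = x}, Z ω ∂μ)
        * M.blockMean (π e) (T n) x := by
  set G := {ω | choice n ω = e} ∩ {ω | s (startTime T n) ω = x}
  have hle := ℱ.le (startTime T n)
  have hG : MeasurableSet[ℱ (startTime T n)] G :=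
    MeasurableSet.inter (h.choice_meas n e) (h.state_meas _ x)
  have hGm := hle _ hG
  have hX : Integrable (G.indicator (avgReward T r n)) μ :=
    (h.integrable_avgReward n).indicator hGm
  have hcond : G.indicator (fun _ => M.blockMean (π e) (T n) x)
      =ᵐ[μ] μ[G.indicator (avgReward T r n) | ℱ (startTime T n)] := by
    refine ae_eq_condExp_of_forall_setIntegral_eq hle hX
      (fun _ _ _ => ((integrable_const _).indicator hGm).integrableOn) (fun D hD _ => ?_)
      (stronglyMeasurable_const.indicator hG).aestronglyMeasurable
    rw [setIntegral_indicator hGm, setIntegral_indicator hGm,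
      h.setIntegral_avgReward (MeasurableSet.inter hD hG) fun ω hω => hω.2]
    simp
  have hb : ∀ᵐ ω ∂μ, ‖avgReward T r n ω‖ ≤ 1 := (h.avgReward_mem n).mono fun ω hω => by
    rw [Real.norm_of_nonneg hω.1]; exact hω.2
  have hZX : Integrable (Z * G.indicator (avgReward T r n)) μ := by
    have h1 : Integrable (fun ω => Z ω * avgReward T r n ω) μ :=
      hZi.mul_bdd (c := 1) (h.measurable_avgReward n).aestronglyMeasurable hb
    refine (h1.indicator hGm).congr (Eventually.of_forall fun ω => ?_)
    simp only [Pi.mul_apply, Set.indicator]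
    split_ifs <;> simp
  have hpull := condExp_mul_of_stronglyMeasurable_left hZ hZX hX
  calc ∫ ω in G, Z ω * avgReward T r n ω ∂μ
      = ∫ ω, (Z * G.indicator (avgReward T r n)) ω ∂μ := by
        rw [← integral_indicator hGm]
        refine integral_congr_ae (Eventually.of_forall fun ω => ?_)
        simp only [Pi.mul_apply, Set.indicator]
        split_ifs <;> simp
    _ = ∫ ω, μ[Z * G.indicator (avgReward T r n) | ℱ (startTime T n)] ω ∂μ :=
        (integral_condExp hle).symm
    _ = ∫ ω, G.indicator (fun ω => Z ω * M.blockMean (π e) (T n) x) ω ∂μ := by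
        refine integral_congr_ae ?_
        filter_upwards [hpull, hcond] with ω h1 h2
        rw [h1, Pi.mul_apply, ← h2]
        simp only [Set.indicator]
        split_ifs <;> simp
    _ = _ := by rw [integral_indicator hGm, integral_mul_const]

/-- One step of the supermartingale estimate. The hypothesis bounds the conditional mean from above
when `0 ≤ l` and from below when `l ≤ 0`. -/
theorem setIntegral_mul_exp_avgReward_le [Finite E] (h : IsBanditRun M π T μ ℱ s a r choice)
    (n : ℕ) (e : E) {l b : ℝ} (hb : ∀ x, l * M.blockMean (π e) (T n) x ≤ l * b) {Z : Ω → ℝ}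
    (hZ : StronglyMeasurable[ℱ (startTime T n)] Z) (hZi : Integrable Z μ) (hZ0 : ∀ ω, 0 ≤ Z ω) :
    ∫ ω in {ω | choice n ω = e}, Z ω * Real.exp (l * avgReward T r n ω) ∂μ
      ≤ (∫ ω in {ω | choice n ω = e}, Z ω ∂μ) * Real.exp (l * b + l ^ 2 / 2) := by
  have hc := h.measurableSet_choice n e
  have hs := h.measurableSet_state (startTime T n)
  have hi := h.integrable_mul_exp_avgReward n l hZi
  have hZX : Integrable (fun ω => Z ω * avgReward T r n ω) μ :=
    hZi.mul_bdd (c := 1) (h.measurable_avgReward n).aestronglyMeasurable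
      ((h.avgReward_mem n).mono fun ω hω => by rw [Real.norm_of_nonneg hω.1]; exact hω.2)
  rw [setIntegral_eq_sum_fiber hi hs hc, setIntegral_eq_sum_fiber hZi hs hc, Finset.sum_mul]
  refine Finset.sum_le_sum fun x _ => ?_
  set G := {ω | choice n ω = e} ∩ {ω | s (startTime T n) ω = x}
  calc ∫ ω in G, Z ω * Real.exp (l * avgReward T r n ω) ∂μ
      ≤ ∫ ω in G, (Z ω + (Real.exp l - 1) * (Z ω * avgReward T r n ω)) ∂μ := by
        refine setIntegral_mono_ae hi.integrableOn (hZi.add (hZX.const_mul _)).integrableOn ?_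
        filter_upwards [h.avgReward_mem n] with ω hω
        have := mul_le_mul_of_nonneg_left (exp_mul_le_one_add_mul l hω) (hZ0 ω)
        linarith
    _ = (∫ ω in G, Z ω ∂μ) * (1 + M.blockMean (π e) (T n) x * (Real.exp l - 1)) := by
        rw [integral_add hZi.integrableOn (hZX.const_mul _).integrableOn, integral_const_mul,
          h.setIntegral_mul_avgReward n e x hZ hZi]
        ring
    _ ≤ _ := by
        refine mul_le_mul_of_nonneg_left ?_ (integral_nonneg hZ0)
        refine (one_add_mul_exp_sub_one_le l (M.blockMean_mem _ _ x)).trans ?_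
        exact Real.exp_le_exp.2 (by linarith [hb x])

end IsBanditRun

/-! ### Concentration of the empirical means -/

section Pulls

variable {Ω E : Type*} [DecidableEq E] (T : ℕ → ℕ) (r : ℕ → Ω → ℝ) (choice : ℕ → Ω → E) (e : E)

theorem pullCount_succ (n : ℕ) (ω : Ω) :
    pullCount choice e (n + 1) ω = pullCount choice e n ω + if choice n ω = e then 1 else 0 := by
  simp only [pullCount, Finset.card_filter, Finset.sum_range_succ]

theorem pullSum_succ (n : ℕ) (ω : Ω) :
    pullSum T r choice e (n + 1) ω
      = pullSum T r choice e n ω + if choice n ω = e then avgReward T r n ω else 0 := by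
  simp only [pullSum, Finset.sum_filter, Finset.sum_range_succ]

theorem pullCount_le (n : ℕ) (ω : Ω) : pullCount choice e n ω ≤ n :=
  (Finset.card_filter_le _ _).trans (Finset.card_range n).le

/-- The exponential weight that turns the centred sum of rewards of the expert `e` into a
supermartingale: `l` is the exponent, `b` the centring. -/
noncomputable def expWeight (l b : ℝ) (n : ℕ) (ω : Ω) : ℝ :=
  Real.exp (l * (pullSum T r choice e n ω - pullCount choice e n ω * b)
    - pullCount choice e n ω * (l ^ 2 / 2))

theorem expWeight_succ (l b : ℝ) (n : ℕ) (ω : Ω) :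
    expWeight T r choice e l b (n + 1) ω = expWeight T r choice e l b n ω *
      if choice n ω = e then Real.exp (l * avgReward T r n ω) * Real.exp (-(l * b + l ^ 2 / 2))
      else 1 := by
  rw [expWeight, expWeight, pullCount_succ, pullSum_succ]
  split_ifs
  · rw [← Real.exp_add, ← Real.exp_add]
    congr 1
    push_cast
    ring
  · simp

end Pulls

namespace IsBanditRun

variable {S A E Ω : Type*} [Fintype S] [Fintype A] [DecidableEq E]
  [mΩ : MeasurableSpace Ω]
  {M : RewardMDP S A} {π : E → StationaryPolicy S A} {T : ℕ → ℕ} {μ : Measure Ω}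
  {ℱ : Filtration ℕ mΩ} {s : ℕ → Ω → S} {a : ℕ → Ω → A} {r : ℕ → Ω → ℝ} {choice : ℕ → Ω → E}

theorem measurable_pullCount (h : IsBanditRun M π T μ ℱ s a r choice) (e : E) (n : ℕ) :
    Measurable[ℱ (startTime T n)] (fun ω => (pullCount choice e n ω : ℝ)) := by
  simp only [pullCount, Finset.card_filter, Nat.cast_sum]
  refine Finset.measurable_fun_sum _ fun m hm => ?_
  push_cast
  exact Measurable.ite (ℱ.mono (startTime_mono T (Finset.mem_range.1 hm).le) _
    (h.choice_meas m e)) measurable_const measurable_const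

theorem measurable_pullSum (h : IsBanditRun M π T μ ℱ s a r choice) (e : E) (n : ℕ) :
    Measurable[ℱ (startTime T n)] (pullSum T r choice e n) := by
  have : pullSum T r choice e n = fun ω => ∑ m ∈ Finset.range n,
      if choice m ω = e then avgReward T r m ω else 0 := by
    ext ω
    rw [pullSum, Finset.sum_filter]
  rw [this]
  refine Finset.measurable_fun_sum _ fun m hm => ?_
  exact Measurable.ite (ℱ.mono (startTime_mono T (Finset.mem_range.1 hm).le) _
    (h.choice_meas m e)) (h.measurable_avgReward_of_lt (Finset.mem_range.1 hm)) measurable_const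

theorem measurable_expWeight (h : IsBanditRun M π T μ ℱ s a r choice) (e : E) (l b : ℝ) (n : ℕ) :
    Measurable[ℱ (startTime T n)] (expWeight T r choice e l b n) :=
  Real.measurable_exp.comp ((((h.measurable_pullSum e n).sub
    ((h.measurable_pullCount e n).mul_const b)).const_mul l).sub
      ((h.measurable_pullCount e n).mul_const _))

variable [IsProbabilityMeasure μ]

theorem integral_pullCount (h : IsBanditRun M π T μ ℱ s a r choice) (e : E) (n : ℕ) :
    ∫ ω, (pullCount choice e n ω : ℝ) ∂μ
      = ∑ t ∈ Finset.range n, μ.real {ω | choice t ω = e} := by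
  have h1 : ∀ ω, (pullCount choice e n ω : ℝ)
      = ∑ t ∈ Finset.range n, {ω | choice t ω = e}.indicator (fun _ => (1 : ℝ)) ω := by
    intro ω
    rw [pullCount, Finset.card_filter]
    push_cast
    simp only [Set.indicator_apply, Set.mem_ofPred_eq]
  simp only [h1]
  rw [integral_finsetSum _ fun t _ => (integrable_const _).indicator (h.measurableSet_choice t e)]
  simp [integral_indicator_const, h.measurableSet_choice]

theorem integrable_expWeight [Finite E] (h : IsBanditRun M π T μ ℱ s a r choice) (e : E)
    (l b : ℝ) (n : ℕ) : Integrable (expWeight T r choice e l b n) μ := by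
  induction n with
  | zero =>
    have h0 : expWeight T r choice e l b 0 = fun _ => 1 := by
      ext ω
      simp [expWeight, pullSum, pullCount]
    exact h0 ▸ integrable_const 1
  | succ n ih =>
    have hm := h.measurableSet_choice n e
    have h1 := ((h.integrable_mul_exp_avgReward n l ih).mul_const
      (Real.exp (-(l * b + l ^ 2 / 2)))).indicator hm
    refine (h1.add (ih.indicator hm.compl)).congr (Eventually.of_forall fun ω => ?_)
    by_cases hω : choice n ω = e <;> simp [expWeight_succ, hω, mul_assoc]

variable [DecidableEq S]

theorem integral_expWeight_le_one [Finite E] (h : IsBanditRun M π T μ ℱ s a r choice) (e : E)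
    {l b : ℝ} (hb : ∀ n x, l * M.blockMean (π e) (T n) x ≤ l * b) (n : ℕ) :
    ∫ ω, expWeight T r choice e l b n ω ∂μ ≤ 1 := by
  induction n with
  | zero => simp [expWeight, pullSum, pullCount]
  | succ n ih =>
    refine le_trans ?_ ih
    have hm := h.measurableSet_choice n e
    have hW := h.integrable_expWeight e l b n
    rw [← integral_add_compl hm (h.integrable_expWeight e l b (n + 1)),
      ← integral_add_compl hm hW]
    refine add_le_add ?_ (setIntegral_congr_fun hm.compl fun ω hω => ?_).le
    · have h1 : ∫ ω in {ω | choice n ω = e}, expWeight T r choice e l b (n + 1) ω ∂μ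
          = (∫ ω in {ω | choice n ω = e}, expWeight T r choice e l b n ω *
            Real.exp (l * avgReward T r n ω) ∂μ) * Real.exp (-(l * b + l ^ 2 / 2)) := by
        rw [← integral_mul_const]
        refine setIntegral_congr_fun hm fun ω hω => ?_
        simp only [expWeight_succ, if_pos (show choice n ω = e from hω), mul_assoc]
      rw [h1, Real.exp_neg]
      refine mul_inv_le_of_le_mul₀ (Real.exp_pos _).le
        (setIntegral_nonneg hm fun _ _ => (Real.exp_pos _).le) ?_
      exact h.setIntegral_mul_exp_avgReward_le n e (hb n)
        (h.measurable_expWeight e l b n).stronglyMeasurable hW fun ω => (Real.exp_pos _).le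
    · simp only [expWeight_succ, if_neg (show ¬ choice n ω = e from hω), mul_one]

/-- A deviation of the empirical mean after exactly `k` uses of the expert `e`; `σ = ±1` selects the
side, and `σ * b` dominates `σ` times the conditional means. -/
theorem measureReal_deviation_le [Finite E] (h : IsBanditRun M π T μ ℱ s a r choice) (e : E)
    {σ b : ℝ} (hσ : σ ^ 2 = 1) (hb : ∀ n x, σ * M.blockMean (π e) (T n) x ≤ σ * b)
    {n k : ℕ} (hn : 0 < n) (hk : 0 < k) :
    μ.real {ω | pullCount choice e n ω = k ∧
      k * √(8 * Real.log n / k) ≤ σ * (pullSum T r choice e n ω - k * b)} ≤ 1 / (n : ℝ) ^ 4 := by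
  have hn' : (0 : ℝ) < n := Nat.cast_pos.2 hn
  have hk' : (0 : ℝ) < k := Nat.cast_pos.2 hk
  set q := √(8 * Real.log n / k)
  have hq : k * q ^ 2 = 8 * Real.log n := by
    rw [Real.sq_sqrt (div_nonneg (mul_nonneg (by norm_num) (Real.log_natCast_nonneg n)) hk'.le)]
    field_simp
  have hq0 : 0 ≤ q := Real.sqrt_nonneg _
  -- the exponent `σ * q` optimizes the exponential Markov inequality
  have hb' : ∀ n x, σ * q * M.blockMean (π e) (T n) x ≤ σ * q * b := fun n x => by
    have := mul_le_mul_of_nonneg_left (hb n x) hq0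
    linarith
  have hmk := mul_meas_ge_le_integral_of_nonneg (f := expWeight T r choice e (σ * q) b n)
    (Eventually.of_forall fun ω => (Real.exp_pos _).le)
    (h.integrable_expWeight e (σ * q) b n) ((n : ℝ) ^ 4)
  have hle := hmk.trans (h.integral_expWeight_le_one e hb' n)
  rw [le_div_iff₀' (pow_pos hn' 4)]
  refine le_trans (mul_le_mul_of_nonneg_left (measureReal_mono ?_) (pow_pos hn' 4).le) hle
  rintro ω ⟨h1, h2⟩
  have h4 : (n : ℝ) ^ 4 = Real.exp (4 * Real.log n) := by
    rw [mul_comm, Real.exp_mul, Real.exp_log hn']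
    norm_cast
  simp only [Set.mem_ofPred_eq, expWeight, h1]
  rw [h4]
  refine Real.exp_le_exp.2 ?_
  have h5 := mul_le_mul_of_nonneg_left h2 hq0
  have h6 : (σ * q) ^ 2 = q ^ 2 := by rw [mul_pow, hσ, one_mul]
  rw [h6]
  linarith

/-- Union over the possible numbers of uses. At `n = 0` the event is empty, and the right-hand side
is `1 / 0 = 0`. -/
theorem measureReal_exists_deviation_le [Finite E] (h : IsBanditRun M π T μ ℱ s a r choice) (e : E)
    {σ b : ℝ} (hσ : σ ^ 2 = 1) (hb : ∀ n x, σ * M.blockMean (π e) (T n) x ≤ σ * b) (n : ℕ) :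
    μ.real {ω | 0 < pullCount choice e n ω ∧
      pullCount choice e n ω * √(8 * Real.log n / pullCount choice e n ω)
        ≤ σ * (pullSum T r choice e n ω - pullCount choice e n ω * b)} ≤ 1 / (n : ℝ) ^ 2 := by
  calc _ ≤ μ.real (⋃ k ∈ Finset.Icc 1 n, {ω | pullCount choice e n ω = k ∧
          k * √(8 * Real.log n / k) ≤ σ * (pullSum T r choice e n ω - k * b)}) := by
        refine measureReal_mono (fun ω hω => ?_) (measure_ne_top _ _)
        simp only [Set.mem_iUnion, Finset.mem_Icc]
        exact ⟨_, ⟨hω.1, pullCount_le choice e n ω⟩, rfl, hω.2⟩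
    _ ≤ ∑ k ∈ Finset.Icc 1 n, 1 / (n : ℝ) ^ 4 := by
        refine (measureReal_biUnion_finset_le _ _).trans (Finset.sum_le_sum fun k hk => ?_)
        have := Finset.mem_Icc.1 hk
        exact h.measureReal_deviation_le e hσ hb (by omega) (by omega)
    _ ≤ 1 / (n : ℝ) ^ 2 := by
        rw [Finset.sum_const, Nat.card_Icc, Nat.add_sub_cancel, nsmul_eq_mul]
        rcases Nat.eq_zero_or_pos n with rfl | hn
        · simp
        · have hn1 : (1 : ℝ) ≤ n := Nat.one_le_cast.2 hn
          rw [mul_one_div, div_le_div_iff₀ (by positivity) (by positivity)]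
          nlinarith [pow_le_pow_right₀ hn1 (show 3 ≤ 4 by norm_num)]

end IsBanditRun

/-! ### The regret in terms of the experts used -/

section Regret

variable {S A E Ω : Type*} [Fintype S] [Fintype A] [Fintype E]
  [mΩ : MeasurableSpace Ω]
  {M : RewardMDP S A} {π : E → StationaryPolicy S A} {T : ℕ → ℕ} {μ : Measure Ω}
  [IsProbabilityMeasure μ]
  {ℱ : Filtration ℕ mΩ} {s : ℕ → Ω → S} {a : ℕ → Ω → A} {r : ℕ → Ω → ℝ} {choice : ℕ → Ω → E}
  {K Rbar : E → ℝ}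

theorem IsBanditRun.integrable_regret (h : IsBanditRun M π T μ ℱ s a r choice) (R : ℝ) (n : ℕ) :
    Integrable (regret T r R n) μ :=
  (integrable_const _).sub (integrable_finsetSum _ fun k _ => h.integrable_avgReward k)

theorem IsBanditRun.sum_measureReal_choice (h : IsBanditRun M π T μ ℱ s a r choice) (n : ℕ) :
    ∑ e, μ.real {ω | choice n ω = e} = 1 := by
  have := measureReal_eq_sum_fiber (μ := μ) (h.measurableSet_choice n) MeasurableSet.univ
  simpa using this.symm

variable [DecidableEq S]

theorem IsBanditRun.abs_setIntegral_avgReward_sub_le (h : IsBanditRun M π T μ ℱ s a r choice)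
    (hmean : ∀ e n x, |M.blockMean (π e) (T n) x - Rbar e| ≤ K e / T n) (n : ℕ) (e : E) :
    |∫ ω in {ω | choice n ω = e}, avgReward T r n ω ∂μ - μ.real {ω | choice n ω = e} * Rbar e|
      ≤ μ.real {ω | choice n ω = e} * (K e / T n) := by
  have hc := h.measurableSet_choice n e
  have hs := h.measurableSet_state (startTime T n)
  rw [setIntegral_eq_sum_fiber (h.integrable_avgReward n) hs hc, measureReal_eq_sum_fiber hs hc,
    Finset.sum_mul, Finset.sum_mul, ← Finset.sum_sub_distrib]
  refine (Finset.abs_sum_le_sum_abs _ _).trans (Finset.sum_le_sum fun x _ => ?_)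
  rw [h.setIntegral_avgReward (e := e) (x := x) (MeasurableSet.inter (h.choice_meas n e)
    (h.state_meas _ x)) fun ω hω => ⟨hω.1, hω.2⟩, ← mul_sub, abs_mul,
    abs_of_nonneg measureReal_nonneg]
  exact mul_le_mul_of_nonneg_left (hmean e n x) measureReal_nonneg

/-- The expected regret, split according to the expert in charge: gaps weighted by the
probabilities of use, up to the bias of the block means. -/
theorem IsBanditRun.abs_integral_regret_sub_le (h : IsBanditRun M π T μ ℱ s a r choice)
    (hmean : ∀ e n x, |M.blockMean (π e) (T n) x - Rbar e| ≤ K e / T n) (R : ℝ) (n : ℕ) :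
    |∫ ω, regret T r R n ω ∂μ
        - ∑ k ∈ Finset.range n, ∑ e, μ.real {ω | choice k ω = e} * (R - Rbar e)|
      ≤ ∑ k ∈ Finset.range n, ∑ e, μ.real {ω | choice k ω = e} * (K e / T k) := by
  have h1 : ∫ ω, regret T r R n ω ∂μ = ∑ k ∈ Finset.range n, ∑ e,
      (μ.real {ω | choice k ω = e} * R
        - ∫ ω in {ω | choice k ω = e}, avgReward T r k ω ∂μ) := by
    simp only [regret]
    rw [integral_sub (integrable_const _)
      (integrable_finsetSum _ fun k _ => h.integrable_avgReward k),
      integral_finsetSum _ fun k _ => h.integrable_avgReward k]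
    simp only [Finset.sum_sub_distrib, ← Finset.sum_mul, h.sum_measureReal_choice,
      ← integral_eq_sum_fiber (h.integrable_avgReward _) (h.measurableSet_choice _)]
    simp
  rw [h1, ← Finset.sum_sub_distrib]
  refine (Finset.abs_sum_le_sum_abs _ _).trans (Finset.sum_le_sum fun k _ => ?_)
  rw [← Finset.sum_sub_distrib]
  refine (Finset.abs_sum_le_sum_abs _ _).trans (Finset.sum_le_sum fun e _ => ?_)
  refine le_trans (le_of_eq ?_) (h.abs_setIntegral_avgReward_sub_le hmean k e)
  rw [← abs_neg]
  congr 1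
  ring

theorem IsBanditRun.neg_le_integral_regret (h : IsBanditRun M π T μ ℱ s a r choice)
    (hK : ∀ e, 0 ≤ K e)
    (hmean : ∀ e n x, |M.blockMean (π e) (T n) x - Rbar e| ≤ K e / T n)
    {R : ℝ} (hR : ∀ e, Rbar e ≤ R) (n : ℕ) :
    -((∑ e, K e) * ∑ k ∈ Finset.range n, 1 / (T k : ℝ)) ≤ ∫ ω, regret T r R n ω ∂μ := by
  have h1 := (abs_le.1 (h.abs_integral_regret_sub_le hmean R n)).1
  have h2 : 0 ≤ ∑ k ∈ Finset.range n, ∑ e, μ.real {ω | choice k ω = e} * (R - Rbar e) :=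
    Finset.sum_nonneg fun k _ => Finset.sum_nonneg fun e _ =>
      mul_nonneg measureReal_nonneg (sub_nonneg.2 (hR e))
  have h3 : ∑ k ∈ Finset.range n, ∑ e, μ.real {ω | choice k ω = e} * (K e / T k)
      ≤ (∑ e, K e) * ∑ k ∈ Finset.range n, 1 / (T k : ℝ) := by
    rw [Finset.mul_sum]
    refine Finset.sum_le_sum fun k _ => ?_
    rw [mul_one_div, Finset.sum_div]
    exact Finset.sum_le_sum fun e _ =>
      mul_le_of_le_one_left (div_nonneg (hK e) (Nat.cast_nonneg _)) measureReal_le_one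
  linarith

end Regret

/-! ### The number of uses of a suboptimal expert -/

theorem pullCount_le_add_sum {Ω E : Type*} [DecidableEq E] (choice : ℕ → Ω → E) (e : E)
    (l n : ℕ) (ω : Ω) :
    pullCount choice e n ω ≤ l + ∑ t ∈ Finset.range n,
      if choice t ω = e ∧ l ≤ pullCount choice e t ω then 1 else 0 := by
  induction n with
  | zero => simp [pullCount]
  | succ n ih =>
    rw [pullCount_succ, Finset.sum_range_succ]
    split_ifs <;> grind

/-- When the index of the best expert `o` is at most that of `e`, and `e` has been used often enough
for its confidence bound to be below half the gap, one of the two empirical means deviates. -/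
theorem deviation_of_ucbIndex_le {Ω E : Type*} [DecidableEq E] {K : E → ℝ} {T : ℕ → ℕ}
    {r : ℕ → Ω → ℝ} {choice : ℕ → Ω → E} {o e : E} {n : ℕ} {ω : Ω} {Ro Re : ℝ}
    (hle : ucbIndex K T r choice o n ω ≤ ucbIndex K T r choice e n ω)
    (hk : 0 < pullCount choice e n ω)
    (hgap : 2 * K e / (T 0 : ℝ) < Ro - Re)
    (hlog : 32 * Real.log n / (Ro - Re - 2 * K e / (T 0 : ℝ)) ^ 2 < pullCount choice e n ω) :
    (0 < pullCount choice e n ω ∧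
      pullCount choice e n ω * √(8 * Real.log n / pullCount choice e n ω)
        ≤ 1 * (pullSum T r choice e n ω - pullCount choice e n ω * (Re + K e / (T 0 : ℝ)))) ∨
    (0 < pullCount choice o n ω ∧
      pullCount choice o n ω * √(8 * Real.log n / pullCount choice o n ω)
        ≤ -1 * (pullSum T r choice o n ω - pullCount choice o n ω * (Ro - K o / (T 0 : ℝ)))) := by
  by_contra! hcon
  obtain ⟨h1, h2⟩ := hcon
  have hko : 0 < pullCount choice o n ω := by
    by_contra h0
    rw [ucbIndex, ucbIndex, if_pos (by omega), if_neg hk.ne'] at hle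
    exact absurd hle (not_le.2 (EReal.coe_lt_top _))
  rw [ucbIndex, ucbIndex, if_neg hko.ne', if_neg hk.ne', EReal.coe_le_coe_iff, confBound,
    confBound] at hle
  specialize h1 hk
  specialize h2 hko
  have hk' : (0 : ℝ) < pullCount choice e n ω := Nat.cast_pos.2 hk
  have hko' : (0 : ℝ) < pullCount choice o n ω := Nat.cast_pos.2 hko
  generalize (pullCount choice e n ω : ℝ) = k at *
  generalize (pullCount choice o n ω : ℝ) = ko at *
  set q := √(8 * Real.log n / k)
  set qo := √(8 * Real.log n / ko)
  have hq : k * q ^ 2 = 8 * Real.log n := by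
    rw [Real.sq_sqrt (div_nonneg (mul_nonneg (by norm_num) (Real.log_natCast_nonneg n)) hk'.le)]
    field_simp
  have hδ : 0 < Ro - Re - 2 * K e / (T 0 : ℝ) := by linarith
  have hqδ : 2 * q < Ro - Re - 2 * K e / (T 0 : ℝ) := by
    rw [div_lt_iff₀ (pow_pos hδ 2)] at hlog
    refine lt_of_pow_lt_pow_left₀ 2 hδ.le (lt_of_mul_lt_mul_left ?_ hk'.le)
    linarith
  have h3 : pullSum T r choice e n ω / k < Re + K e / (T 0 : ℝ) + q := by
    rw [div_lt_iff₀ hk']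
    linarith
  have h4 : Ro - K o / (T 0 : ℝ) - qo < pullSum T r choice o n ω / ko := by
    rw [lt_div_iff₀ hko']
    linarith
  have h5 : 2 * K e / (T 0 : ℝ) = 2 * (K e / (T 0 : ℝ)) := mul_div_assoc _ _ _
  linarith

section UCB

variable {S A E Ω : Type*} [Fintype S] [DecidableEq S] [Fintype A] [Fintype E] [DecidableEq E]
  [mΩ : MeasurableSpace Ω]
  {M : RewardMDP S A} {π : E → StationaryPolicy S A} {T : ℕ → ℕ} {μ : Measure Ω}
  [IsProbabilityMeasure μ]
  {ℱ : Filtration ℕ mΩ} {s : ℕ → Ω → S} {a : ℕ → Ω → A} {r : ℕ → Ω → ℝ} {choice : ℕ → Ω → E}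
  {K Rbar : E → ℝ}

/-- The logarithmic bound on the expected number of uses of a suboptimal expert. -/
theorem IsBanditRun.integral_pullCount_le (h : IsBanditRun M π T μ ℱ s a r choice)
    (hucb : FollowsUCB K T μ r choice) (hT0 : 0 < T 0) (hT : ∀ n, T 0 ≤ T n)
    (hK : ∀ e, 0 ≤ K e)
    (hmean : ∀ e n x, |M.blockMean (π e) (T n) x - Rbar e| ≤ K e / T n)
    {o e : E} (hgap : 2 * K e / (T 0 : ℝ) < Rbar o - Rbar e) {n : ℕ} :
    ∫ ω, (pullCount choice e n ω : ℝ) ∂μ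
      ≤ 32 * Real.log n / (Rbar o - Rbar e - 2 * K e / (T 0 : ℝ)) ^ 2 + 1 + Real.pi ^ 2 / 3 := by
  have hδ : 0 < Rbar o - Rbar e - 2 * K e / (T 0 : ℝ) := by linarith
  set u := 32 * Real.log n / (Rbar o - Rbar e - 2 * K e / (T 0 : ℝ)) ^ 2
  have hu : 0 ≤ u :=
    div_nonneg (mul_nonneg (by norm_num) (Real.log_natCast_nonneg n)) (sq_nonneg _)
  have hmean0 : ∀ e n x, |M.blockMean (π e) (T n) x - Rbar e| ≤ K e / T 0 := fun e n x =>
    (hmean e n x).trans (div_le_div_of_nonneg_left (hK e) (Nat.cast_pos.2 hT0)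
      (Nat.cast_le.2 (hT n)))
  set l := ⌊u⌋₊ + 1
  have hl : (l : ℝ) ≤ u + 1 := by
    push_cast [l]
    linarith [Nat.floor_le hu]
  let B : ℕ → Set Ω := fun t => {ω | choice t ω = e ∧ l ≤ pullCount choice e t ω}
  have hB : ∀ t, MeasurableSet (B t) := fun t => by
    have h1 := ((h.measurable_pullCount e t).mono (ℱ.le _) le_rfl)
      (measurableSet_Ici (a := (l : ℝ)))
    have h2 : MeasurableSet {ω | l ≤ pullCount choice e t ω} := by
      simpa only [Set.preimage, Set.mem_Ici, Nat.cast_le] using h1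
    exact (h.measurableSet_choice t e).inter h2
  have hBle : ∀ t ∈ Finset.range n, μ.real (B t) ≤ 2 * (1 / (t : ℝ) ^ 2) := by
    intro t ht
    have hup := h.measureReal_exists_deviation_le e (σ := 1) (b := Rbar e + K e / (T 0 : ℝ))
      (one_pow 2) (fun n x => by linarith [(abs_le.1 (hmean0 e n x)).2]) t
    have hlow := h.measureReal_exists_deviation_le o (σ := -1) (b := Rbar o - K o / (T 0 : ℝ))
      (by norm_num) (fun n x => by linarith [(abs_le.1 (hmean0 o n x)).1]) t
    refine le_trans ?_ ((measureReal_union_le _ _).trans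
      ((add_le_add hup hlow).trans_eq (two_mul _).symm))
    refine ENNReal.toReal_mono (measure_ne_top _ _) (measure_mono_ae ?_)
    filter_upwards [hucb] with ω hω hωB
    obtain ⟨hc, hk⟩ := hωB
    have hk0 : 0 < pullCount choice e t ω := by omega
    have ht0 : 0 < t := hk0.trans_le (pullCount_le choice e t ω)
    refine deviation_of_ucbIndex_le (by simpa only [hc] using hω t o) hk0 hgap ?_
    have hlog : Real.log t ≤ Real.log n := Real.log_le_log (Nat.cast_pos.2 ht0)
      (Nat.cast_le.2 (Finset.mem_range.1 ht).le)
    calc _ ≤ u := by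
          refine div_le_div_of_nonneg_right ?_ (sq_nonneg _)
          linarith
      _ < l := by simpa [l] using Nat.lt_floor_add_one u
      _ ≤ _ := Nat.cast_le.2 hk
  have hint : Integrable (fun ω => (l : ℝ) + ∑ t ∈ Finset.range n,
      (B t).indicator (fun _ => (1 : ℝ)) ω) μ :=
    (integrable_const _).add (integrable_finsetSum _ fun t _ =>
      (integrable_const _).indicator (hB t))
  calc ∫ ω, (pullCount choice e n ω : ℝ) ∂μ
      ≤ ∫ ω, ((l : ℝ) + ∑ t ∈ Finset.range n, (B t).indicator (fun _ => (1 : ℝ)) ω) ∂μ := by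
        refine integral_mono_of_nonneg (Eventually.of_forall fun ω => Nat.cast_nonneg _) hint
          (Eventually.of_forall fun ω => ?_)
        have := pullCount_le_add_sum choice e l n ω
        simp only [Set.indicator_apply, B, Set.mem_ofPred_eq]
        exact_mod_cast this
    _ = l + ∑ t ∈ Finset.range n, μ.real (B t) := by
        rw [integral_add (integrable_const _) (integrable_finsetSum _ fun t _ =>
          (integrable_const _).indicator (hB t)),
          integral_finsetSum _ fun t _ => (integrable_const _).indicator (hB t)]
        simp [integral_indicator_const, hB]
    _ ≤ (u + 1) + 2 * (Real.pi ^ 2 / 6) := by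
        refine add_le_add hl ((Finset.sum_le_sum hBle).trans ?_)
        rw [← Finset.mul_sum]
        refine mul_le_mul_of_nonneg_left ?_ zero_le_two
        exact sum_le_hasSum _ (fun t _ => by positivity) hasSum_zeta_two
    _ = _ := by ring

theorem IsBanditRun.integral_regret_le (h : IsBanditRun M π T μ ℱ s a r choice)
    (hucb : FollowsUCB K T μ r choice) (hT0 : 0 < T 0) (hT : ∀ n, T 0 ≤ T n)
    (hK : ∀ e, 0 ≤ K e)
    (hmean : ∀ e n x, |M.blockMean (π e) (T n) x - Rbar e| ≤ K e / T n)
    {o : E} (hgap : ∀ e, e ≠ o → 2 * K e / (T 0 : ℝ) < Rbar o - Rbar e) (n : ℕ) :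
    ∫ ω, regret T r (Rbar o) n ω ∂μ ≤
      ∑ e ∈ Finset.univ.erase o,
        (32 * Real.log (n : ℝ) / (Rbar o - Rbar e - 2 * K e / (T 0 : ℝ)) ^ 2 + 1 + Real.pi ^ 2 / 3)
          * (Rbar o - Rbar e + K e / (T 0 : ℝ))
      + K o * ∑ k ∈ Finset.range n, 1 / (T k : ℝ) := by
  have hT0' : (0 : ℝ) < T 0 := Nat.cast_pos.2 hT0
  have h1 := (abs_le.1 (h.abs_integral_regret_sub_le hmean (Rbar o) n)).2
  have h2 : ∑ k ∈ Finset.range n, ∑ e, μ.real {ω | choice k ω = e} * (Rbar o - Rbar e)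
      + ∑ k ∈ Finset.range n, ∑ e, μ.real {ω | choice k ω = e} * (K e / T k)
      = ∑ e ∈ Finset.univ.erase o, ∑ k ∈ Finset.range n,
          μ.real {ω | choice k ω = e} * (Rbar o - Rbar e + K e / T k)
        + ∑ k ∈ Finset.range n, μ.real {ω | choice k ω = o} * (K o / T k) := by
    simp only [← Finset.sum_add_distrib, ← mul_add]
    rw [Finset.sum_comm, ← Finset.sum_erase_add _ _ (Finset.mem_univ o)]
    simp
  have h3 : ∑ k ∈ Finset.range n, μ.real {ω | choice k ω = o} * (K o / T k)
      ≤ K o * ∑ k ∈ Finset.range n, 1 / (T k : ℝ) := by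
    rw [Finset.mul_sum]
    refine Finset.sum_le_sum fun k _ => ?_
    rw [mul_one_div]
    exact mul_le_of_le_one_left (div_nonneg (hK o) (Nat.cast_nonneg _)) measureReal_le_one
  have h4 : ∀ e ∈ Finset.univ.erase o, ∑ k ∈ Finset.range n,
      μ.real {ω | choice k ω = e} * (Rbar o - Rbar e + K e / T k)
      ≤ (32 * Real.log (n : ℝ) / (Rbar o - Rbar e - 2 * K e / (T 0 : ℝ)) ^ 2 + 1 + Real.pi ^ 2 / 3)
          * (Rbar o - Rbar e + K e / (T 0 : ℝ)) := by
    intro e he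
    have hg := hgap e (Finset.ne_of_mem_erase he)
    have hg0 : 0 ≤ 2 * K e / (T 0 : ℝ) :=
      div_nonneg (mul_nonneg zero_le_two (hK e)) hT0'.le
    have hk0 : 0 ≤ K e / (T 0 : ℝ) := div_nonneg (hK e) hT0'.le
    refine le_trans ?_ (mul_le_mul_of_nonneg_right
      (h.integral_pullCount_le hucb hT0 hT hK hmean hg (n := n)) (by linarith))
    rw [h.integral_pullCount, Finset.sum_mul]
    refine Finset.sum_le_sum fun k _ => mul_le_mul_of_nonneg_left ?_ measureReal_nonneg
    have := div_le_div_of_nonneg_left (hK e) hT0' (Nat.cast_le (α := ℝ).2 (hT k))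
    linarith
  linarith [Finset.sum_le_sum h4]

end UCB

/-! ### Linearly growing horizons -/

theorem sum_one_div_isBigO_log {T : ℕ → ℕ} (hT0 : 0 < T 0) {c : ℝ} (hc : 0 < c)
    (hT : ∀ n, T n = T 0 + ⌊c * (n : ℝ)⌋₊) :
    (fun n : ℕ => ∑ k ∈ Finset.range n, 1 / (T k : ℝ)) =O[atTop]
      fun n : ℕ => Real.log (n : ℝ) := by
  set d := min 1 c / 2
  have hd : 0 < d := half_pos (lt_min one_pos hc)
  have hlow : ∀ k, d * (k + 1) ≤ T k := by
    intro k
    have h1 : (1 : ℝ) ≤ T 0 := Nat.one_le_cast.2 hT0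
    have h2 : c * k < ⌊c * (k : ℝ)⌋₊ + 1 := Nat.lt_floor_add_one _
    have h3 : (T k : ℝ) = T 0 + ⌊c * (k : ℝ)⌋₊ := by exact_mod_cast hT k
    have h4 : (0 : ℝ) ≤ ⌊c * (k : ℝ)⌋₊ := Nat.cast_nonneg _
    have h5 : min 1 c * k ≤ c * k := mul_le_mul_of_nonneg_right (min_le_right _ _) k.cast_nonneg
    have h6 : min 1 c ≤ 1 := min_le_left _ _
    have h7 : d * (k + 1) = (min 1 c * k + min 1 c) / 2 := by ring
    linarith
  refine IsBigO.of_bound (2 / d) ?_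
  filter_upwards [eventually_ge_atTop 3] with n hn
  have hlog : 1 ≤ Real.log n := by
    rw [Real.le_log_iff_exp_le (by positivity)]
    exact Real.exp_one_lt_three.le.trans (by exact_mod_cast hn)
  have hharm := harmonic_le_one_add_log n
  rw [Real.norm_of_nonneg (Finset.sum_nonneg fun k _ => by positivity),
    Real.norm_of_nonneg (by linarith)]
  calc ∑ k ∈ Finset.range n, 1 / (T k : ℝ)
      ≤ ∑ k ∈ Finset.range n, 1 / d * ((k : ℝ) + 1)⁻¹ := by
        refine Finset.sum_le_sum fun k _ => ?_
        rw [← one_div, one_div_mul_one_div]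
        exact one_div_le_one_div_of_le (by positivity) (hlow k)
    _ = 1 / d * (harmonic n : ℝ) := by
        rw [← Finset.mul_sum, harmonic]
        push_cast
        rfl
    _ ≤ 1 / d * (2 * Real.log n) := by
        refine mul_le_mul_of_nonneg_left ?_ (by positivity)
        linarith
    _ = _ := by ring

/-! ### The two regret bounds -/

theorem proposition3
    {S A E Ω : Type*} [Fintype S] [DecidableEq S] [Fintype A] [Fintype E] [DecidableEq E]
    [mΩ : MeasurableSpace Ω] (P : Measure Ω) [IsProbabilityMeasure P]
    -- the environment and the experts
    (M : RewardMDP S A) (π : E → StationaryPolicy S A)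
    (hirr : ∀ e, (M.chain (π e)).IsIrreducible)
    (haper : ∀ e, IsAperiodicChain (M.chain (π e)))
    -- stationary distributions and mixing constants of the induced chains
    (ν : E → S → ℝ) (hν : ∀ e, IsStationaryDistribution (M.chain (π e)) (ν e))
    (C α : E → ℝ) (hmix : ∀ e, IsMixingPair (M.chain (π e)) (ν e) (C e) (α e))
    (K : E → ℝ) (hK : ∀ e, K e = C e / (1 - α e))
    -- steady-state rewards, the best expert and the gaps
    (Rbar : E → ℝ) (hRbar : ∀ e, Rbar e = M.steadyReward (π e) (ν e))
    (estar : E) (hestar : ∀ e, Rbar e ≤ Rbar estar)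
    (Δ : E → ℝ) (hΔ : ∀ e, Δ e = Rbar estar - Rbar e)
    -- the time horizons
    (T : ℕ → ℕ) (hT0 : 0 < T 0) (hT : ∀ n, T 0 ≤ T n)
    (hgap : ∀ e, e ≠ estar → 2 * K e / (T 0 : ℝ) < Δ e)
    -- a run of the UCB algorithm on the MDP
    (ℱ : Filtration ℕ mΩ) (s : ℕ → Ω → S) (a : ℕ → Ω → A) (r : ℕ → Ω → ℝ) (choice : ℕ → Ω → E)
    (hrun : IsBanditRun M π T P ℱ s a r choice)
    (hucb : FollowsUCB K T P r choice) :
    (∀ n : ℕ, 1 ≤ n →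
      Integrable (regret T r (Rbar estar) n) P ∧
      ∫ ω, regret T r (Rbar estar) n ω ∂P ≤
        ∑ e ∈ Finset.univ.erase estar,
          (32 * Real.log (n : ℝ) / (Δ e - 2 * K e / (T 0 : ℝ)) ^ 2 + 1 + Real.pi ^ 2 / 3)
            * (Δ e + K e / (T 0 : ℝ))
        + K estar * ∑ k ∈ Finset.range n, 1 / (T k : ℝ)) ∧
    ((∃ c : ℝ, 0 < c ∧ ∀ n, T n = T 0 + ⌊c * (n : ℝ)⌋₊) →
      (fun n : ℕ => ∫ ω, regret T r (Rbar estar) n ω ∂P) =O[atTop]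
        fun n : ℕ => Real.log (n : ℝ)) := by
  have hα : ∀ e, 0 < 1 - α e := fun e => sub_pos.2 (hmix e).2.1
  obtain ⟨x₀⟩ := M.nonempty_state
  have hC0 : ∀ e, 0 ≤ C e := fun e => (hmix e).nonneg_left x₀
  have hK0 : ∀ e, 0 ≤ K e := fun e => by
    rw [hK]
    exact div_nonneg (hC0 e) (hα e).le
  have hmean : ∀ e n x, |M.blockMean (π e) (T n) x - Rbar e| ≤ K e / T n := fun e n x => by
    rw [hRbar, hK]
    exact M.abs_blockMean_sub_le (π e) (hmix e) (hC0 e) (hT0.trans_le (hT n)) x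
  have hupper := hrun.integral_regret_le hucb hT0 hT hK0 hmean (o := estar)
    fun e he => hΔ e ▸ hgap e he
  simp only [← hΔ] at hupper
  refine ⟨fun n _ => ⟨hrun.integrable_regret _ n, hupper n⟩, ?_⟩
  rintro ⟨c, hc, hTc⟩
  have hS := sum_one_div_isBigO_log hT0 hc hTc
  have hlogT : Tendsto (fun n : ℕ => Real.log (n : ℝ)) atTop atTop :=
    Real.tendsto_log_atTop.comp tendsto_natCast_atTop_atTop
  have hconst : ∀ b : ℝ, (fun _ : ℕ => b) =O[atTop] fun n : ℕ => Real.log (n : ℝ) := fun b =>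
    (isLittleO_const_left.2 (Or.inr (tendsto_norm_atTop_atTop.comp hlogT))).isBigO
  have hU : (fun n : ℕ => ∑ e ∈ Finset.univ.erase estar,
        (32 * Real.log (n : ℝ) / (Δ e - 2 * K e / (T 0 : ℝ)) ^ 2 + 1 + Real.pi ^ 2 / 3)
          * (Δ e + K e / (T 0 : ℝ))
      + K estar * ∑ k ∈ Finset.range n, 1 / (T k : ℝ)) =O[atTop]
      fun n : ℕ => Real.log (n : ℝ) := by
    refine (IsBigO.fun_sum fun e _ => ?_).add (hS.const_mul_left _)
    have h1 : (fun n : ℕ => 32 * Real.log (n : ℝ) / (Δ e - 2 * K e / (T 0 : ℝ)) ^ 2) =O[atTop]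
        fun n : ℕ => Real.log (n : ℝ) := by
      simp only [mul_div_right_comm]
      exact (isBigO_refl _ _).const_mul_left _
    simpa only [mul_comm] using
      ((h1.add (hconst 1)).add (hconst (Real.pi ^ 2 / 3))).const_mul_left (Δ e + K e / (T 0 : ℝ))
  -- the regret may be negative, so that its lower bound is needed as well
  have hL := hS.const_mul_left (∑ e, K e)
  refine IsBigO.trans (IsBigO.of_bound 1 (Eventually.of_forall fun n => ?_))
    (hU.norm_left.add hL.norm_left)
  have h1 := hupper n
  have h2 := hrun.neg_le_integral_regret hK0 hmean hestar n
  rw [one_mul, Real.norm_eq_abs]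
  refine (abs_le.2 ⟨?_, ?_⟩).trans (Real.le_norm_self _)
  · rw [neg_le]
    refine (neg_le.1 h2).trans ((Real.le_norm_self _).trans ?_)
    exact le_add_of_nonneg_left (norm_nonneg _)
  · refine h1.trans ((Real.le_norm_self _).trans ?_)
    exact le_add_of_nonneg_right (norm_nonneg _)
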